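/- Let $R$ be a Gorenstein local ring (that is, a commutative Noetherian local ring of finite injective dimension over itself) of Krull dimension one, and let $I$ be an ideal of $R$ containing a regular element (a non-zero-divisor of $R$). Then the ring $\operatorname{End}_R(I)$ of $R$-linear endomorphisms of $I$ is commutative. Suppose that $I$ is rigid, that is, $\operatorname{Ext}^1_R(I,I)=0$, and that $\operatorname{End}_R(I)$ is a Gorenstein ring, that is, it is Noetherian and its localization at every maximal ideal is a Gorenstein local ring. Then $I$ is a principal ideal. -/

import Mathlib

open CategoryTheory

universe u

/-- A Noetherian local ring is Gorenstein if it has finite injective dimension as a module over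
itself. -/
class IsGorensteinLocalRing (R : Type u) [CommRing R] : Prop
    extends IsLocalRing R, IsNoetherianRing R where
  exists_hasInjectiveDimensionLE : ∃ n : ℕ, HasInjectiveDimensionLE (ModuleCat.of R R) n

/-- A (not necessarily local) Noetherian commutative ring is Gorenstein if its localization at
every maximal ideal is a Gorenstein local ring. -/
class IsGorensteinRing (R : Type u) [CommRing R] : Prop extends IsNoetherianRing R where
  localization_atPrime : ∀ (m : Ideal R) [m.IsMaximal],
    IsGorensteinLocalRing (Localization.AtPrime m)

/-- A module `M` over `R` is rigid if `Ext¹_R(M, M) = 0`. -/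
def IsRigidModule (R : Type u) [CommRing R] (M : Type u) [AddCommGroup M] [Module R M] : Prop :=
  Subsingleton (Abelian.Ext.{u} (ModuleCat.of R M) (ModuleCat.of R M) 1)

/-- Endomorphisms of an ideal that contains a regular element commute. -/
theorem Ideal.end_mul_comm {R : Type u} [CommRing R] {I : Ideal R}
    (hI : ∃ x ∈ I, x ∈ nonZeroDivisors R) (f g : Module.End R I) : f * g = g * f := by
  obtain ⟨x, hxI, hx⟩ := hI
  have key : ∀ (h : Module.End R I) (y : I), x * (h y : R) = (y : R) * (h ⟨x, hxI⟩ : R) := by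
    intro h y
    have e : x • y = (y : R) • (⟨x, hxI⟩ : I) := Subtype.ext (mul_comm x (y : R))
    have e' := congrArg (fun z : I => (z : R)) (congrArg h e)
    simpa only [map_smul, Submodule.coe_smul, smul_eq_mul] using e'
  ext y
  have hfg : x * (x * (f (g y) : R)) = x * (x * (g (f y) : R)) := by
    rw [key f (g y), key g (f y), ← mul_assoc, ← mul_assoc, key g y, key f y]
    ring
  exact (mul_cancel_left_mem_nonZeroDivisors hx).1
    ((mul_cancel_left_mem_nonZeroDivisors hx).1 hfg)

/-- The endomorphism ring `End_R(I)` of an ideal `I` that contains a regular element, with its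
usual ring structure, as a commutative ring. -/
abbrev Ideal.endCommRing {R : Type u} [CommRing R] (I : Ideal R)
    (hI : ∃ x ∈ I, x ∈ nonZeroDivisors R) : CommRing (Module.End R I) :=
  { (inferInstance : Ring (Module.End R I)) with
    mul_comm := Ideal.end_mul_comm hI }

/-! Let E = End_R(I) and let `x` be a regular element of `I`; if `x` is a unit, I = R. Otherwise
`I`, embedded in E by multiplications, is an ideal J with (J : J) = E. The ring E is integral over
`R`, semilocal and Gorenstein, so the duality (x) : ((x) : J) = J makes J invertible: x lies in J ·
((x) : J) (`Ideal.mem_mul_colon_of_forall_dvd`).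

Rigidity makes every endomorphism act on I/𝔪I by a scalar (`IsRigidModule.exists_sub_smul_mem`).
Write x as a sum of products jc = xg with g in E. These g sum to 1, so by Nakayama some g acts by a
nonzero scalar. Comparing its j with an arbitrary y in `I` gives I = Rj + 𝔪I, and Nakayama makes `I`
principal. -/

/-! ### Vanishing of Ext along short exact sequences. -/

section Ext

open Abelian

variable {R : Type u} [CommRing R] {A B C : Type u} [AddCommGroup A] [AddCommGroup B]
  [AddCommGroup C] [Module R A] [Module R B] [Module R C]

theorem ModuleCat.shortExact_moduleCatMk {f : A →ₗ[R] B} {g : B →ₗ[R] C}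
    (hf : Function.Injective f) (hg : Function.Surjective g) (h : Function.Exact f g) :
    (ShortComplex.moduleCatMk f g h.linearMap_comp_eq_zero).ShortExact where
  exact := (ShortComplex.ShortExact.moduleCat_exact_iff_function_exact _).2 h
  mono_f := (ModuleCat.mono_iff_injective _).2 hf
  epi_g := (ModuleCat.epi_iff_surjective _).2 hg

/-- If `Ext¹(P, A) = 0`, maps from `P` lift along surjections with kernel `A`. -/
theorem LinearMap.exists_comp_eq_of_subsingleton_ext {f : A →ₗ[R] B} {g : B →ₗ[R] C}
    (hf : Function.Injective f) (hg : Function.Surjective g) (h : Function.Exact f g)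
    {P : Type u} [AddCommGroup P] [Module R P]
    (hP : Subsingleton (Ext.{u} (ModuleCat.of R P) (ModuleCat.of R A) 1)) (φ : P →ₗ[R] C) :
    ∃ ψ : P →ₗ[R] B, g ∘ₗ ψ = φ := by
  have hS := ModuleCat.shortExact_moduleCatMk hf hg h
  obtain ⟨x, hx⟩ := Ext.covariant_sequence_exact₃ (ModuleCat.of R P) hS
    (Ext.mk₀ (ModuleCat.ofHom φ)) (n₁ := 1) rfl (hP.elim _ _)
  obtain ⟨ψ, rfl⟩ := Ext.addEquiv₀.symm.surjective x
  refine ⟨ψ.hom, ?_⟩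
  rw [Ext.addEquiv₀_symm_apply, Ext.mk₀_comp_mk₀] at hx
  exact congrArg ModuleCat.Hom.hom (Ext.addEquiv₀.symm.injective hx)

variable (N : ModuleCat.{u} R)

theorem subsingleton_ext_left {f : A →ₗ[R] B} {g : B →ₗ[R] C}
    (hf : Function.Injective f) (hg : Function.Surjective g) (h : Function.Exact f g) {i : ℕ}
    (hB : Subsingleton (Ext.{u} (ModuleCat.of R B) N i))
    (hC : Subsingleton (Ext.{u} (ModuleCat.of R C) N (i + 1))) :
    Subsingleton (Ext.{u} (ModuleCat.of R A) N i) := by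
  refine subsingleton_of_forall_eq 0 fun e ↦ ?_
  obtain ⟨x, rfl⟩ := Ext.contravariant_sequence_exact₁
    (ModuleCat.shortExact_moduleCatMk hf hg h) N e (n₁ := i + 1) (add_comm _ _) (hC.elim _ _)
  obtain rfl : x = 0 := hB.elim _ _
  exact Ext.comp_zero ..

theorem subsingleton_ext_middle {f : A →ₗ[R] B} {g : B →ₗ[R] C}
    (hf : Function.Injective f) (hg : Function.Surjective g) (h : Function.Exact f g) {i : ℕ}
    (hA : Subsingleton (Ext.{u} (ModuleCat.of R A) N i))
    (hC : Subsingleton (Ext.{u} (ModuleCat.of R C) N i)) :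
    Subsingleton (Ext.{u} (ModuleCat.of R B) N i) := by
  refine subsingleton_of_forall_eq 0 fun e ↦ ?_
  obtain ⟨x, rfl⟩ := Ext.contravariant_sequence_exact₂
    (ModuleCat.shortExact_moduleCatMk hf hg h) N e (hA.elim _ _)
  obtain rfl : x = 0 := hC.elim _ _
  exact Ext.comp_zero ..

theorem subsingleton_ext_right {f : A →ₗ[R] B} {g : B →ₗ[R] C}
    (hf : Function.Injective f) (hg : Function.Surjective g) (h : Function.Exact f g) {i : ℕ}
    (hA : Subsingleton (Ext.{u} (ModuleCat.of R A) N i))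
    (hB : Subsingleton (Ext.{u} (ModuleCat.of R B) N (i + 1))) :
    Subsingleton (Ext.{u} (ModuleCat.of R C) N (i + 1)) := by
  refine subsingleton_of_forall_eq 0 fun e ↦ ?_
  obtain ⟨x, rfl⟩ := Ext.contravariant_sequence_exact₃
    (ModuleCat.shortExact_moduleCatMk hf hg h) N e (hB.elim _ _) (n₀ := i) (add_comm _ _)
  obtain rfl : x = 0 := hA.elim _ _
  exact Ext.comp_zero ..

theorem subsingleton_ext_of_linearEquiv (e : A ≃ₗ[R] B) {i : ℕ}
    (hB : Subsingleton (Ext.{u} (ModuleCat.of R B) N i)) :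
    Subsingleton (Ext.{u} (ModuleCat.of R A) N i) := by
  refine subsingleton_of_forall_eq 0 fun z ↦ ?_
  have h1 : (Ext.mk₀ (e.toModuleIso.hom ≫ e.toModuleIso.inv)).comp z (zero_add i) = 0 := by
    rw [← Ext.mk₀_comp_mk₀_assoc, hB.elim (Ext.comp _ z _) 0, Ext.comp_zero]
  rwa [Iso.hom_inv_id, Ext.mk₀_id_comp] at h1

end Ext

/-! ### Socle elements modulo `x`. -/

section PrimesOver

variable {S : Type u} [CommRing S] [IsNoetherianRing S] {x : S}

/-- If all primes containing `x` are maximal, each of them is associated to `S / (x)`. -/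
theorem Ideal.exists_notMem_span_singleton_of_forall_isMaximal
    (hx : ∀ p : Ideal S, p.IsPrime → x ∈ p → p.IsMaximal) (n : Ideal S) [n.IsPrime]
    (hn : x ∈ n) :
    ∃ y, y ∉ Ideal.span {x} ∧ ∀ a ∈ n, a * y ∈ Ideal.span {x} := by
  have hmin : n ∈ (Module.annihilator S (S ⧸ Ideal.span {x})).minimalPrimes := by
    rw [Ideal.annihilator_quotient]
    refine ⟨⟨inferInstance, by simpa [Ideal.span_le] using hn⟩, fun q hq hqn ↦ ?_⟩
    have hq' := hx q hq.1 (hq.2 (Ideal.mem_span_singleton_self x))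
    exact (hq'.eq_of_le (Ideal.IsPrime.ne_top ‹_›) hqn).ge
  have hass := Module.associatedPrimes.minimalPrimes_annihilator_subset_associatedPrimes _ _ hmin
  obtain ⟨-, z, hz⟩ := isAssociatedPrime_iff.1 hass
  obtain ⟨y, rfl⟩ := Ideal.Quotient.mk_surjective z
  have key : ∀ a, a ∈ n ↔ a * y ∈ Ideal.span {x} := fun a ↦ by
    rw [hz, Submodule.mem_colon_singleton, Submodule.mem_bot, ← Ideal.Quotient.eq_zero_iff_mem]
    rfl
  refine ⟨y, fun hy ↦ ?_, fun a ha ↦ (key a).1 ha⟩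
  exact (Ideal.ne_top_iff_one n).1 (Ideal.IsPrime.ne_top ‹_›) ((key 1).2 (by simpa using hy))

end PrimesOver

/-! ### Duality in dimension one and invertible ideals. -/

section Gorenstein

open Abelian

variable {S : Type u} [CommRing S] [IsNoetherianRing S] {x : S}

theorem exact_mulLeft_mkQ {S : Type u} [CommRing S] (x : S) :
    Function.Exact (LinearMap.mulLeft S x) (Ideal.span {x}).mkQ := fun a ↦ by
  rw [Submodule.mkQ_apply, Submodule.Quotient.mk_eq_zero, Ideal.mem_span_singleton]
  simp [dvd_def, eq_comm]

theorem subsingleton_ext_self {S : Type u} [CommRing S] (N : ModuleCat.{u} S) (i : ℕ) :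
    Subsingleton (Ext.{u} (ModuleCat.of S S) N (i + 1)) :=
  have : Projective (ModuleCat.of S S) := (IsProjective.iff_projective S).1 inferInstance
  subsingleton_of_forall_eq 0 Ext.eq_zero_of_projective

/-- Descending induction on the degree, starting above the injective dimension. A prime filtration
reduces to S/n with n maximal and containing `x`. It embeds in S/(x), whose Ext vanishes from degree
2 on, and the cokernel is handled one degree higher. -/
theorem subsingleton_ext_of_isTorsion {d : ℕ} [HasInjectiveDimensionLE (ModuleCat.of S S) d]
    (hreg : x ∈ nonZeroDivisors S) (hx : ∀ p : Ideal S, p.IsPrime → x ∈ p → p.IsMaximal)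
    (M : Type u) [AddCommGroup M] [Module S M] [Module.Finite S M]
    (hM : ∀ m : M, ∃ k : ℕ, x ^ k • m = 0) (i : ℕ) :
    Subsingleton (Ext.{u} (ModuleCat.of S M) (ModuleCat.of S S) (i + 2)) := by
  suffices H : ∀ k i : ℕ, d ≤ i + k → ∀ (M : Type u) [AddCommGroup M] [Module S M]
      [Module.Finite S M], (∀ m : M, ∃ k : ℕ, x ^ k • m = 0) →
      Subsingleton (Ext.{u} (ModuleCat.of S M) (ModuleCat.of S S) (i + 2)) from
    H d i (Nat.le_add_left _ _) M hM
  intro k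
  induction k with
  | zero =>
    intro i hi M _ _ _ _
    exact HasInjectiveDimensionLT.subsingleton _ (d + 1) _ (by lia) _
  | succ k ih =>
    intro i hi M _ _ hfin hM
    induction hfin using IsNoetherianRing.induction_on_isQuotientEquivQuotientPrime S with
    | subsingleton N =>
      refine subsingleton_of_forall_eq 0 fun e ↦ ?_
      have : (Ext.mk₀ (𝟙 (ModuleCat.of S N))).comp e (zero_add _) = 0 := by
        rw [(ModuleCat.isZero_of_subsingleton (ModuleCat.of S N)).eq_of_src (𝟙 _) 0, Ext.mk₀_zero,
          Ext.zero_comp]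
      rwa [Ext.mk₀_id_comp] at this
    | quotient N p e =>
      refine subsingleton_ext_of_linearEquiv _ e ?_
      have hxp : x ∈ p.1 := by
        obtain ⟨l, hl⟩ := hM (e.symm 1)
        rw [← map_smul, LinearEquiv.map_eq_zero_iff, Algebra.smul_def, mul_one] at hl
        exact p.2.mem_of_pow_mem l (Ideal.Quotient.eq_zero_iff_mem.1 hl)
      have hmax := hx p.1 p.2 hxp
      have := p.2
      obtain ⟨z, hz, hpz⟩ := Ideal.exists_notMem_span_singleton_of_forall_isMaximal hx p.1 hxp
      let g : S →ₗ[S] S ⧸ Ideal.span {x} := (Ideal.span {x}).mkQ ∘ₗ LinearMap.toSpanSingleton S S z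
      have hg : ∀ a, g a = 0 ↔ a * z ∈ Ideal.span {x} := fun a ↦
        Submodule.Quotient.mk_eq_zero _
      have hker : LinearMap.ker g = p.1 := by
        refine (hmax.eq_of_le ?_ fun a ha ↦ (hg a).2 (hpz a ha)).symm
        rw [Ideal.ne_top_iff_one, LinearMap.mem_ker, hg, one_mul]
        exact hz
      let f : (S ⧸ p.1) →ₗ[S] S ⧸ Ideal.span {x} := Submodule.liftQ p.1 g hker.ge
      have hf : Function.Injective f :=
        LinearMap.ker_eq_bot.1 (Submodule.ker_liftQ_eq_bot _ _ _ hker.le)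
      refine subsingleton_ext_left _ hf (Submodule.mkQ_surjective (LinearMap.range f))
        (LinearMap.exact_map_mkQ_range f) ?_ (ih (i + 1) (by lia) _ fun m ↦ ⟨1, ?_⟩)
      · refine subsingleton_ext_right (A := S) (B := S) (f := LinearMap.mulLeft S x)
          (g := (Ideal.span {x}).mkQ) _ ?_ (Submodule.mkQ_surjective _) (exact_mulLeft_mkQ x)
          (subsingleton_ext_self _ i) (subsingleton_ext_self _ (i + 1))
        intro a b hab
        exact (mul_cancel_left_mem_nonZeroDivisors hreg).1 hab
      · obtain ⟨m, rfl⟩ := Submodule.mkQ_surjective _ m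
        obtain ⟨m, rfl⟩ := Submodule.mkQ_surjective _ m
        rw [pow_one, ← map_smul, ← map_smul]
        have : (Ideal.span {x}).mkQ (x • m) = 0 := by
          rw [Submodule.mkQ_apply, Submodule.Quotient.mk_eq_zero]
          exact Ideal.mul_mem_right _ _ (Ideal.mem_span_singleton_self x)
        rw [this, map_zero]
    | exact N₁ N₂ N₃ f g hf hg hfg h₁ h₃ =>
      refine subsingleton_ext_middle _ hf hg hfg (h₁ fun n ↦ ?_) (h₃ fun n ↦ ?_)
      · obtain ⟨l, hl⟩ := hM (f n)
        exact ⟨l, hf (by rw [map_smul, hl, map_zero])⟩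
      · obtain ⟨n, rfl⟩ := hg n
        obtain ⟨l, hl⟩ := hM n
        exact ⟨l, by rw [← map_smul, hl, map_zero]⟩

/-- In a ring of finite self-injective dimension, an ideal `J` containing a regular element `x`
such that the primes over `x` are maximal satisfies `(x) : ((x) : J) = J`. -/
theorem Ideal.mem_of_forall_mul_mem_span_singleton {d : ℕ}
    [HasInjectiveDimensionLE (ModuleCat.of S S) d]
    (hreg : x ∈ nonZeroDivisors S) (hx : ∀ p : Ideal S, p.IsPrime → x ∈ p → p.IsMaximal)
    {J : Ideal S} (hxJ : x ∈ J) {y : S}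
    (hy : ∀ c, (∀ j ∈ J, c * j ∈ Ideal.span {x}) → c * y ∈ Ideal.span {x}) : y ∈ J := by
  by_contra hyJ
  have htop : J.colon {y} ≠ ⊤ := by
    rw [Ideal.ne_top_iff_one, Submodule.mem_colon_singleton, one_smul]
    exact hyJ
  obtain ⟨n, hn, hJn⟩ := Ideal.exists_le_maximal _ htop
  have hJn' : ∀ a, a * y ∈ J → a ∈ n := fun a ha ↦ hJn (Submodule.mem_colon_singleton.2 ha)
  obtain ⟨z, hz, hnz⟩ := Ideal.exists_notMem_span_singleton_of_forall_isMaximal hx n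
    (hJn' x (J.mul_mem_right _ hxJ))
  -- The range of `π` is J + Sy. Sending j + ey to the class of ez is well defined on it, as j + ey
  -- = 0 forces e into (J : y), hence into `n`, which kills z modulo `x`.
  let π : J × S →ₗ[S] S := LinearMap.coprod J.subtype (LinearMap.toSpanSingleton S S y)
  have hπ : ∀ j e, π (j, e) = j + e * y := fun j e ↦ by simp [π]
  let g : J × S →ₗ[S] S ⧸ Ideal.span {x} :=
    (Ideal.span {x}).mkQ ∘ₗ LinearMap.toSpanSingleton S S z ∘ₗ LinearMap.snd S J S
  have hg : ∀ j e, g (j, e) = (Ideal.span {x}).mkQ (e * z) := fun j e ↦ by simp [g]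
  have hle : LinearMap.ker π ≤ LinearMap.ker g := by
    rintro ⟨j, e⟩ h
    rw [LinearMap.mem_ker, hπ] at h
    rw [LinearMap.mem_ker, hg, Submodule.mkQ_apply, Submodule.Quotient.mk_eq_zero]
    refine hnz e (hJn' e ?_)
    rw [eq_neg_of_add_eq_zero_right h]
    exact J.neg_mem j.2
  let φ : LinearMap.range π →ₗ[S] S ⧸ Ideal.span {x} :=
    (LinearMap.ker π).liftQ g hle ∘ₗ π.quotKerEquivRange.symm.toLinearMap
  have hφ : ∀ (j : J) e (h : (j : S) + e * y ∈ LinearMap.range π),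
      φ ⟨j + e * y, h⟩ = (Ideal.span {x}).mkQ (e * z) := fun j e h ↦ by
    have : π.quotKerEquivRange ((LinearMap.ker π).mkQ (j, e)) = ⟨(j : S) + e * y, h⟩ :=
      Subtype.ext (by simp [π])
    rw [LinearMap.comp_apply, ← this]
    simp [hg]
  have hxr : ∀ j (hj : j ∈ J), j ∈ LinearMap.range π :=
    fun j hj ↦ ⟨(⟨j, hj⟩, 0), by simp [hπ]⟩
  have hyr : y ∈ LinearMap.range π := ⟨(0, 1), by simp [hπ]⟩
  have hext : Subsingleton (Ext.{u} (ModuleCat.of S (LinearMap.range π)) (ModuleCat.of S S) 1) := by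
    refine subsingleton_ext_left _ (LinearMap.range π).injective_subtype
      (Submodule.mkQ_surjective _) (LinearMap.exact_subtype_mkQ _) (subsingleton_ext_self _ 0)
      (subsingleton_ext_of_isTorsion (d := d) hreg hx _ (fun m ↦ ⟨1, ?_⟩) 0)
    obtain ⟨m, rfl⟩ := Submodule.mkQ_surjective _ m
    rw [pow_one, ← map_smul, Submodule.mkQ_apply, Submodule.Quotient.mk_eq_zero]
    exact hxr _ (J.mul_mem_right _ hxJ)
  -- The lift `ψ` is multiplication by some `c` with cJ ⊆ (x). Then `hy` puts cy in (x), although cy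
  -- lifts the nonzero class of z.
  obtain ⟨ψ, hψ⟩ := LinearMap.exists_comp_eq_of_subsingleton_ext (f := LinearMap.mulLeft S x)
    (g := (Ideal.span {x}).mkQ)
    (fun a b hab ↦ (mul_cancel_left_mem_nonZeroDivisors hreg).1 hab) (Submodule.mkQ_surjective _)
    (exact_mulLeft_mkQ x) hext φ
  have hψJ : ∀ j (hj : j ∈ J), ψ ⟨j, hxr j hj⟩ ∈ Ideal.span {x} := fun j hj ↦ by
    rw [← Submodule.Quotient.mk_eq_zero, ← Submodule.mkQ_apply, ← LinearMap.comp_apply, hψ]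
    simpa using hφ ⟨j, hj⟩ 0 (by simpa using hxr j hj)
  obtain ⟨c, hc⟩ := Ideal.mem_span_singleton.1 (hψJ x hxJ)
  have hmul : ∀ r : LinearMap.range π, ψ r = c * r := fun r ↦ by
    refine (mul_cancel_left_mem_nonZeroDivisors hreg).1 ?_
    have : x • r = (r : S) • (⟨x, hxr x hxJ⟩ : LinearMap.range π) :=
      Subtype.ext (mul_comm x (r : S))
    rw [← smul_eq_mul, ← map_smul, this, map_smul, hc, smul_eq_mul]
    ring
  have hcy := hy c fun j hj ↦ by simpa only [hmul] using hψJ j hj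
  refine hz ?_
  have h1 := hφ 0 1 (by simpa using hyr)
  rw [← hψ, LinearMap.comp_apply, hmul] at h1
  simp only [ZeroMemClass.coe_zero, zero_add, one_mul] at h1
  rw [← Submodule.Quotient.mk_eq_zero, ← Submodule.mkQ_apply, ← h1, Submodule.mkQ_apply,
    Submodule.Quotient.mk_eq_zero]
  exact hcy

/-- An ideal `J` as above with `(J : J) = S` is invertible. -/
theorem Ideal.mem_mul_colon_of_forall_dvd {d : ℕ} [HasInjectiveDimensionLE (ModuleCat.of S S) d]
    (hreg : x ∈ nonZeroDivisors S) (hx : ∀ p : Ideal S, p.IsPrime → x ∈ p → p.IsMaximal)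
    {J : Ideal S} (hxJ : x ∈ J) (hJ : ∀ y, (∀ j ∈ J, ∃ j' ∈ J, y * j = x * j') → x ∣ y) :
    x ∈ J * (Ideal.span {x}).colon J := by
  set C := (Ideal.span {x}).colon (J : Set S)
  have hC : ∀ c, c ∈ C ↔ ∀ j ∈ J, c * j ∈ Ideal.span {x} := fun c ↦ Submodule.mem_colon
  have hxC : x ∈ C :=
    (hC x).2 fun j _ ↦ Ideal.mul_mem_right _ _ (Ideal.mem_span_singleton_self x)
  by_contra hxJC
  have htop : (J * C).colon {x} ≠ ⊤ := by
    rw [Ideal.ne_top_iff_one, Submodule.mem_colon_singleton, one_smul]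
    exact hxJC
  obtain ⟨n, hn, hle⟩ := Ideal.exists_le_maximal _ htop
  have hTn : ∀ t, t * x ∈ J * C → t ∈ n := fun t ht ↦ hle (Submodule.mem_colon_singleton.2 ht)
  obtain ⟨z, hz, hnz⟩ := Ideal.exists_notMem_span_singleton_of_forall_isMaximal hx n
    (hTn x (Ideal.mul_mem_mul hxJ hxC))
  -- By this divisibility (zj/x)c lies in (x) for all c in `C`, so duality puts zj/x in J. Thus z/x
  -- stabilizes J, and `hJ` gives the contradiction x ∣ z.
  have key : ∀ j ∈ J, ∀ c ∈ C, ∃ w, z * j * c = x * (x * w) := fun j hj c hc ↦ by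
    obtain ⟨t, ht⟩ := Ideal.mem_span_singleton.1 ((hC c).1 hc j hj)
    have htn : t ∈ n := hTn t (by
      rw [mul_comm t x, ← ht, mul_comm c j]
      exact Ideal.mul_mem_mul hj hc)
    obtain ⟨w, hw⟩ := Ideal.mem_span_singleton.1 (hnz t htn)
    exact ⟨w, by rw [← hw]; linear_combination z * ht⟩
  refine hz (Ideal.mem_span_singleton.2 (hJ z fun j hj ↦ ?_))
  obtain ⟨w, hw⟩ := key j hj x hxC
  have hzw : z * j = x * w :=
    (mul_cancel_left_mem_nonZeroDivisors hreg).1 (by rw [← hw]; ring)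
  refine ⟨w, Ideal.mem_of_forall_mul_mem_span_singleton (d := d) hreg hx hxJ fun c hc ↦ ?_, hzw⟩
  obtain ⟨w', hw'⟩ := key j hj c ((hC c).2 hc)
  refine Ideal.mem_span_singleton.2 ⟨w', ?_⟩
  refine (mul_cancel_left_mem_nonZeroDivisors hreg).1 ?_
  rw [← hw', hzw]
  ring

/-- A localization of a module `M` is isomorphic to `M.localizedModule`. -/
noncomputable def ModuleCat.localizedModuleEquiv {S : Type u} [CommRing S] {T : Submonoid S}
    {M : ModuleCat.{u} S} {M' : Type u} [AddCommGroup M'] [Module S M'] [Module (Localization T) M']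
    [IsScalarTower S (Localization T) M'] (f : M →ₗ[S] M') [IsLocalizedModule T f] :
    M' ≃ₗ[Localization T] M.localizedModule T :=
  (IsLocalizedModule.linearEquiv T f
    (M.localizedModuleMkLinearMap T)).extendScalarsOfIsLocalization T (Localization T)

/-- A Gorenstein ring with finitely many maximal ideals has finite self-injective dimension. -/
theorem IsGorensteinRing.exists_hasInjectiveDimensionLE (S : Type u) [CommRing S] [IsGorensteinRing S]
    [Finite (MaximalSpectrum S)] :
    ∃ d : ℕ, HasInjectiveDimensionLE (ModuleCat.of S S) d := by
  have h : ∀ m : MaximalSpectrum S, ∃ d : ℕ,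
      HasInjectiveDimensionLE ((ModuleCat.of S S).localizedModule m.1.primeCompl) d := by
    intro m
    have := m.2
    obtain ⟨d, hd⟩ :=
      (IsGorensteinRing.localization_atPrime m.1).exists_hasInjectiveDimensionLE
    refine ⟨d, ?_⟩
    let e : Localization.AtPrime m.1 ≃ₗ[Localization.AtPrime m.1]
        (ModuleCat.of S S).localizedModule m.1.primeCompl :=
      ModuleCat.localizedModuleEquiv (M := ModuleCat.of S S)
        (Algebra.linearMap S (Localization.AtPrime m.1))
    exact hasInjectiveDimensionLT_of_iso e.toModuleIso (d + 1)
  choose d hd using h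
  obtain ⟨D, hD⟩ := (Set.finite_range d).bddAbove
  refine ⟨D, (ModuleCat.hasInjectiveDimensionLE_iff_forall_maximalSpectrum D _).2 fun m ↦ ?_⟩
  have := hd m
  exact hasInjectiveDimensionLT_of_ge _ (d m + 1) _ (by
    have := hD (Set.mem_range_self m)
    lia)

theorem finite_maximalSpectrum_of_forall_isMaximal
    (hx : ∀ p : Ideal S, p.IsPrime → x ∈ p → p.IsMaximal)
    (hx' : ∀ p : Ideal S, p.IsMaximal → x ∈ p) : Finite (MaximalSpectrum S) := by
  have := (Ideal.span {x}).finite_minimalPrimes_of_isNoetherianRing S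
  refine @Finite.of_injective _ _ this.to_subtype
    (fun m : MaximalSpectrum S ↦ (⟨m.1, ⟨m.2.isPrime, by simpa [Ideal.span_le] using hx' _ m.2⟩,
      fun q hq hqn ↦ ?_⟩ : (Ideal.span {x}).minimalPrimes)) ?_
  · exact ((hx q hq.1 (hq.2 (Ideal.mem_span_singleton_self x))).eq_of_le m.2.ne_top hqn).ge
  · intro a b hab
    exact MaximalSpectrum.ext (congrArg Subtype.val hab)

end Gorenstein

/-! ### Rigid ideals and their endomorphism rings. -/

section Rigid

open IsLocalRing

variable {R : Type u} [CommRing R]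

theorem Ideal.isMaximal_of_mem_of_ringKrullDim_le_one (hdim : ringKrullDim R ≤ 1) {x : R}
    (hx : x ∈ nonZeroDivisors R) (p : Ideal R) (hp : p.IsPrime) (hxp : x ∈ p) : p.IsMaximal := by
  have h1 := (ringKrullDim_quotient_succ_le_of_nonZeroDivisor hx).trans hdim
  have h0 : Ring.KrullDimLE 0 (R ⧸ Ideal.span {x}) := by
    rw [Ring.KrullDimLE, Order.krullDimLE_iff]
    change ringKrullDim _ ≤ _
    revert h1
    generalize ringKrullDim (R ⧸ Ideal.span {x}) = d
    induction d with
    | bot => exact fun _ ↦ bot_le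
    | coe d =>
      induction d with
      | top => exact fun h ↦ absurd h (by decide)
      | coe d =>
        intro h
        norm_cast at h ⊢
        lia
  have hle : Ideal.span {x} ≤ p := by simpa [Ideal.span_le] using hxp
  obtain ⟨q, hq, hqp⟩ := Ideal.exists_minimalPrimes_le hle
  have hk : RingHom.ker (Ideal.Quotient.mk (Ideal.span {x})) ≤ p := by rwa [Ideal.mk_ker]
  have := Ideal.map_isPrime_of_surjective Ideal.Quotient.mk_surjective hk
  have hmax := Ideal.IsPrime.isMaximal' this
  have := Ideal.comap_isMaximal_of_surjective _ Ideal.Quotient.mk_surjective (K := p.map _)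
    (H := hmax)
  rwa [Ideal.comap_map_of_surjective _ Ideal.Quotient.mk_surjective, ← RingHom.ker_eq_comap_bot,
    sup_eq_left.2 hk] at this

variable {I : Ideal R} {x : R}

theorem Ideal.mul_injective_of_mem_nonZeroDivisors (hreg : x ∈ nonZeroDivisors R) :
    Function.Injective (algebraMap R (Module.End R I) x) := fun _ _ hab ↦
  Subtype.ext ((mul_cancel_left_mem_nonZeroDivisors hreg).1 (congrArg Subtype.val hab))

theorem Ideal.smul_end_apply_comm (h : Module.End R I) (a y : I) :
    (a : R) • h y = (y : R) • h a := by
  rw [← map_smul, ← map_smul]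
  exact congrArg h (Subtype.ext (mul_comm (a : R) y))

variable [IsLocalRing R] [IsNoetherianRing R]

/-- Every endomorphism of a rigid ideal `I` acts on `I / 𝔪 I` by a scalar. -/
theorem IsRigidModule.exists_sub_smul_mem (hrigid : IsRigidModule R I)
    (hreg : x ∈ nonZeroDivisors R) (hx : ∀ p : Ideal R, p.IsPrime → x ∈ p → p.IsMaximal)
    (hxI : x ∈ I) (hxm : x ∈ maximalIdeal R) (e : Module.End R I) :
    ∃ c : R, ∀ y : I, e y - c • y ∈ maximalIdeal R • (⊤ : Submodule R I) := by
  set m := maximalIdeal R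
  set μ := algebraMap R (Module.End R I) x
  have hμ : ∀ y, μ y = x • y := fun y ↦ rfl
  let : Field (R ⧸ m) := Ideal.Quotient.field m
  let V := I ⧸ m • (⊤ : Submodule R I)
  have hsurj : Function.Surjective (algebraMap R (R ⧸ m)) := Ideal.Quotient.mk_surjective
  let eR : V →ₗ[R] V := Submodule.mapQ _ _ e (by
    rw [← Submodule.map_le_iff_le_comap, Submodule.map_smul'']
    exact Submodule.smul_mono le_rfl le_top)
  let eV : V →ₗ[R ⧸ m] V := eR.extendScalarsOfSurjective hsurj
  have heV : ∀ y : I, eV ((m • (⊤ : Submodule R I)).mkQ y) = (m • (⊤ : Submodule R I)).mkQ (e y) :=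
    fun y ↦ rfl
  -- An endomorphism with every vector an eigenvector is a scalar. Otherwise some functional `f`
  -- kills v but not ev. Following it with an embedding of R/𝔪 in I/xI gives a map I → I/xI, which
  -- lifts to an endomorphism `ψ` by rigidity. As `ψ` commutes with `e`, ψ(y) ∈ xI forces ψ(ey) ∈
  -- xI, a contradiction.
  have hdep : ∀ v, ¬ LinearIndependent (R ⧸ m) ![v, eV v] := by
    intro v hv
    have hspan : eV v ∉ Submodule.span (R ⧸ m) {v} := by
      rw [LinearIndependent.pair_iff] at hv
      rw [Submodule.mem_span_singleton]
      rintro ⟨a, ha⟩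
      have := (hv a (-1) (by rw [ha, neg_one_smul, add_neg_cancel])).2
      simp at this
    obtain ⟨f, hf, hle⟩ := Submodule.exists_le_ker_of_notMem hspan
    have hfv : f v = 0 := hle (Submodule.mem_span_singleton_self v)
    obtain ⟨y, rfl⟩ := Submodule.mkQ_surjective _ v
    have hQ : Nontrivial (I ⧸ LinearMap.range μ) := by
      rw [Submodule.Quotient.nontrivial_iff]
      intro htop
      obtain ⟨w, hw⟩ : (⟨x, hxI⟩ : I) ∈ LinearMap.range μ := htop ▸ Submodule.mem_top
      have h1 : x * w = x * 1 := by
        rw [mul_one]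
        exact congrArg Subtype.val hw
      have h2 : (w : R) = 1 := (mul_cancel_left_mem_nonZeroDivisors hreg).1 h1
      have hI : I = ⊤ := (Ideal.eq_top_iff_one I).2 (h2 ▸ w.2)
      obtain ⟨w', hw'⟩ : (⟨1, hI ▸ Submodule.mem_top⟩ : I) ∈ LinearMap.range μ :=
        htop ▸ Submodule.mem_top
      refine (Ideal.ne_top_iff_one m).1 (maximalIdeal.isMaximal R).ne_top ?_
      rw [← show x * w' = 1 from congrArg Subtype.val hw']
      exact m.mul_mem_right _ hxm
    obtain ⟨p, hp⟩ := associatedPrimes.nonempty R (I ⧸ LinearMap.range μ)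
    obtain ⟨hpp, s, hs⟩ := isAssociatedPrime_iff.1 hp
    have hps : ∀ a, a ∈ p ↔ a • s = 0 := fun a ↦ by
      rw [hs, Submodule.mem_colon_singleton, Submodule.mem_bot]
    have hpm : p = m := by
      refine eq_maximalIdeal (hx p hpp ((hps x).2 ?_))
      obtain ⟨s, rfl⟩ := Submodule.mkQ_surjective _ s
      rw [← map_smul, Submodule.mkQ_apply, Submodule.Quotient.mk_eq_zero]
      exact ⟨s, rfl⟩
    rw [hpm] at hps
    let σ : (R ⧸ m) →ₗ[R] I ⧸ LinearMap.range μ :=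
      Submodule.liftQ m (LinearMap.toSpanSingleton R _ s) fun a ha ↦ (hps a).1 ha
    have hσ : ∀ a, σ a = 0 → a = 0 := fun a ha ↦ by
      obtain ⟨a, rfl⟩ := Ideal.Quotient.mk_surjective a
      exact Ideal.Quotient.eq_zero_iff_mem.2 ((hps a).2 ha)
    let φ : I →ₗ[R] I ⧸ LinearMap.range μ :=
      σ ∘ₗ f.restrictScalars R ∘ₗ (m • (⊤ : Submodule R I)).mkQ
    obtain ⟨ψ, hψ⟩ := LinearMap.exists_comp_eq_of_subsingleton_ext (f := μ)
      (Ideal.mul_injective_of_mem_nonZeroDivisors hreg) (Submodule.mkQ_surjective _)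
      (LinearMap.exact_map_mkQ_range μ) hrigid φ
    have hφy : (LinearMap.range μ).mkQ (ψ y) = 0 := by
      rw [← LinearMap.comp_apply, hψ]
      exact (congrArg σ hfv).trans (map_zero σ)
    obtain ⟨w, hw⟩ := (Submodule.Quotient.mk_eq_zero _).1 hφy
    have hcomm : ψ (e y) = e (ψ y) :=
      LinearMap.congr_fun (Ideal.end_mul_comm ⟨x, hxI, hreg⟩ ψ e) y
    have hφey : φ (e y) = 0 := by
      rw [← hψ, LinearMap.comp_apply, hcomm, ← hw, hμ, map_smul, Submodule.mkQ_apply,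
        Submodule.Quotient.mk_eq_zero]
      exact ⟨e w, rfl⟩
    exact hf (hσ _ hφey)
  obtain ⟨c, hc⟩ := LinearMap.exists_eq_smul_id_of_forall_notLinearIndependent hdep
  obtain ⟨c, rfl⟩ := Ideal.Quotient.mk_surjective c
  refine ⟨c, fun y ↦ ?_⟩
  rw [← Submodule.Quotient.mk_eq_zero, Submodule.Quotient.mk_sub, sub_eq_zero]
  exact LinearMap.congr_fun hc ((m • (⊤ : Submodule R I)).mkQ y)

/-- The element `x` of an ideal `I` with Gorenstein endomorphism ring `E` lies in
`I E · (x E : I E)`. -/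
theorem Ideal.mem_mul_colon_of_isGorensteinRing_end (hreg : x ∈ nonZeroDivisors R)
    (hx : ∀ p : Ideal R, p.IsPrime → x ∈ p → p.IsMaximal) (hxI : x ∈ I)
    (hxm : x ∈ maximalIdeal R) {E : Type u} [CommRing E] [IsGorensteinRing E]
    (Φ : E ≃+* Module.End R I) {J : Ideal E}
    (hJ : ∀ f, f ∈ J ↔ ∃ a ∈ I, Φ f = algebraMap R (Module.End R I) a) :
    Φ.symm (algebraMap R (Module.End R I) x) ∈
      J * (Ideal.span {Φ.symm (algebraMap R (Module.End R I) x)}).colon J := by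
  let ι : R →+* E := (Φ.symm : Module.End R I →+* E).comp (algebraMap R (Module.End R I))
  have hΦι : ∀ a, Φ (ι a) = algebraMap R (Module.End R I) a := fun a ↦ Φ.apply_symm_apply _
  change ι x ∈ J * (Ideal.span {ι x}).colon J
  have hint : ι.IsIntegral := fun f ↦ by
    obtain ⟨p, hp, hpf⟩ := Algebra.IsIntegral.isIntegral (R := R) (Φ f)
    refine ⟨p, hp, ?_⟩
    have h := Polynomial.hom_eval₂ p (algebraMap R (Module.End R I))
      (Φ.symm : Module.End R I →+* E) (Φ f)
    rw [hpf, map_zero] at h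
    simpa using h.symm
  have hreg' : ι x ∈ nonZeroDivisors E := by
    rw [mem_nonZeroDivisors_iff_left]
    intro f hf
    apply Φ.injective
    have h := congrArg Φ hf
    rw [map_mul, hΦι, map_zero] at h
    rw [map_zero]
    ext y
    have h' := LinearMap.congr_fun h y
    exact congrArg Subtype.val (Ideal.mul_injective_of_mem_nonZeroDivisors hreg
      (h'.trans (map_zero _).symm))
  have hmax : ∀ p : Ideal E, p.IsPrime → ι x ∈ p → p.IsMaximal := fun p hp hxp ↦
    Ideal.isMaximal_of_isIntegral_of_isMaximal_comap' ι hint p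
      (hx _ (Ideal.comap_isPrime ι p) hxp)
  have hmem : ∀ p : Ideal E, p.IsMaximal → ι x ∈ p := fun p hp ↦ by
    have h := Ideal.isMaximal_comap_of_isIntegral_of_isMaximal' ι hint p
    rw [← eq_maximalIdeal h] at hxm
    exact hxm
  have := finite_maximalSpectrum_of_forall_isMaximal hmax hmem
  obtain ⟨d, hd⟩ := IsGorensteinRing.exists_hasInjectiveDimensionLE E
  refine Ideal.mem_mul_colon_of_forall_dvd (d := d) hreg' hmax
    ((hJ _).2 ⟨x, hxI, hΦι x⟩) fun f hf ↦ ?_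
  -- If fJ ⊆ xJ, then f maps `I` into xI, so f/x is again an endomorphism of `I`. This is (J : J) =
  -- E.
  have hf' : ∀ a : I, ∃ b : I, Φ f a = x • b := fun a ↦ by
    obtain ⟨j, hj, hfj⟩ := hf (ι a) ((hJ _).2 ⟨a, a.2, hΦι a⟩)
    obtain ⟨b, hb, hjb⟩ := (hJ j).1 hj
    refine ⟨⟨b, hb⟩, ?_⟩
    have h := congrArg Φ hfj
    rw [map_mul, map_mul, hΦι, hΦι, hjb] at h
    have h' := congrArg Subtype.val (LinearMap.congr_fun h ⟨x, hxI⟩)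
    have h1 : Φ f ((a : R) • ⟨x, hxI⟩) = (a : R) • Φ f ⟨x, hxI⟩ := map_smul _ _ _
    have h2 := congrArg Subtype.val
      ((Ideal.smul_end_apply_comm (Φ f) ⟨x, hxI⟩ a).trans h1.symm)
    refine Subtype.ext ((mul_cancel_left_mem_nonZeroDivisors hreg).1 (h2.trans (h'.trans ?_)))
    change x * (b * x) = x * (x * b)
    ring
  choose b hb using hf'
  have hinj := Ideal.mul_injective_of_mem_nonZeroDivisors (I := I) hreg
  let g : Module.End R I :=
    { toFun := b
      map_add' := fun y z ↦ hinj (by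
        change x • b (y + z) = x • (b y + b z)
        rw [smul_add, ← hb, ← hb, ← hb, map_add])
      map_smul' := fun r y ↦ hinj (by
        change x • b (r • y) = x • r • b y
        rw [smul_comm, ← hb, ← hb, map_smul]) }
  refine ⟨Φ.symm g, Φ.injective ?_⟩
  rw [map_mul, hΦι, Φ.apply_symm_apply]
  exact LinearMap.ext hb

/-- Transporting along `Φ` keeps the commutative structure on `E` apart from the standard ring
structure on `Module.End R I`. -/
theorem IsRigidModule.isPrincipal_of_isGorensteinRing_end (hrigid : IsRigidModule R I)
    (hreg : x ∈ nonZeroDivisors R) (hx : ∀ p : Ideal R, p.IsPrime → x ∈ p → p.IsMaximal)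
    (hxI : x ∈ I) (hxm : x ∈ maximalIdeal R) {E : Type u} [CommRing E] [IsGorensteinRing E]
    (Φ : E ≃+* Module.End R I) : I.IsPrincipal := by
  by_contra hI
  have hinj := Ideal.mul_injective_of_mem_nonZeroDivisors (I := I) hreg
  let J : Ideal E :=
    { carrier := {f | ∃ a ∈ I, Φ f = algebraMap R (Module.End R I) a}
      zero_mem' := ⟨0, I.zero_mem, by rw [map_zero, map_zero]⟩
      add_mem' := by
        rintro f g ⟨a, ha, hf⟩ ⟨b, hb, hg⟩
        exact ⟨a + b, I.add_mem ha hb, by rw [map_add, map_add, hf, hg]⟩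
      smul_mem' := by
        rintro f g ⟨a, ha, hg⟩
        refine ⟨Φ f ⟨a, ha⟩, (Φ f ⟨a, ha⟩).2, ?_⟩
        rw [smul_eq_mul, map_mul, hg]
        ext y
        have h := congrArg Subtype.val (Ideal.smul_end_apply_comm (Φ f) ⟨a, ha⟩ y)
        have h' := congrArg Subtype.val ((Φ f).map_smul a y)
        exact h'.trans (h.trans (mul_comm _ _)) }
  have hJ : ∀ f, f ∈ J ↔ ∃ a ∈ I, Φ f = algebraMap R (Module.End R I) a := fun f ↦ Iff.rfl
  set ξ := Φ.symm (algebraMap R (Module.End R I) x)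
  have hξ : Φ ξ = algebraMap R (Module.End R I) x := Φ.apply_symm_apply _
  have hmem := Ideal.mem_mul_colon_of_isGorensteinRing_end hreg hx hxI hxm Φ hJ
  set N := maximalIdeal R • (⊤ : Submodule R I)
  have hjac : maximalIdeal R ≤ (⊥ : Ideal R).jacobson := maximalIdeal_le_jacobson _
  have key : ∀ t ∈ J * (Ideal.span {ξ}).colon J, ∃ g : E, t = ξ * g ∧ ∀ y, Φ g y ∈ N := by
    intro t ht
    refine Submodule.mul_induction_on ht (fun j hj c hc ↦ ?_) ?_
    · rw [Submodule.mem_colon] at hc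
      obtain ⟨a, ha, hja⟩ := (hJ j).1 hj
      obtain ⟨g, hg⟩ := Ideal.mem_span_singleton.1 (hc j hj)
      refine ⟨g, by rw [← hg, mul_comm, smul_eq_mul], ?_⟩
      obtain ⟨r, hr⟩ := hrigid.exists_sub_smul_mem hreg hx hxI hxm (Φ g)
      have hga : ∀ y : I, x • Φ g y = a • Φ c y := fun y ↦ by
        have h := LinearMap.congr_fun (congrArg Φ hg) y
        rw [smul_eq_mul, map_mul, map_mul, hja, hξ] at h
        exact h.symm.trans ((Φ c).map_smul _ _)
      by_cases hrm : r ∈ maximalIdeal R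
      · intro y
        have := N.add_mem (hr y) (Submodule.smul_mem_smul hrm (Submodule.mem_top (x := y)))
        rwa [sub_add_cancel] at this
      · exfalso
        obtain ⟨u, hu⟩ := (notMem_maximalIdeal.1 hrm)
        have hle : (⊤ : Submodule R I) ≤ Submodule.span R {⟨a, ha⟩} := by
          refine Submodule.le_of_le_smul_of_le_jacobson_bot (IsNoetherian.noetherian _) hjac
            fun y _ ↦ ?_
          obtain ⟨gy, hgy⟩ := Ideal.mem_span_singleton.1
            (hc (Φ.symm (algebraMap R (Module.End R I) y)) ((hJ _).2 ⟨y, y.2, by simp⟩))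
          obtain ⟨l, hl⟩ := hrigid.exists_sub_smul_mem hreg hx hxI hxm (Φ gy)
          -- Times x, both sides become a · c(y) = y · c(a). Modulo 𝔪I they are l·a and r·y, and r
          -- is a unit.
          have hgya : Φ gy ⟨a, ha⟩ = Φ g y := hinj (by
            change x • Φ gy ⟨a, ha⟩ = x • Φ g y
            have h := LinearMap.congr_fun (congrArg Φ hgy) ⟨a, ha⟩
            rw [smul_eq_mul, map_mul, map_mul, Φ.apply_symm_apply, hξ] at h
            rw [hga, Ideal.smul_end_apply_comm (Φ c) ⟨a, ha⟩ y]
            exact h.symm.trans ((Φ c).map_smul _ _))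
          have h1 := hl ⟨a, ha⟩
          have h2 := hr y
          rw [hgya] at h1
          have h3 : r • y ∈ Submodule.span R {(⟨a, ha⟩ : I)} ⊔ N := by
            have : r • y = l • (⟨a, ha⟩ : I) + ((Φ g y - l • ⟨a, ha⟩) - (Φ g y - r • y)) := by abel
            rw [this]
            exact Submodule.add_mem_sup
              (Submodule.smul_mem _ _ (Submodule.mem_span_singleton_self _)) (N.sub_mem h1 h2)
          rw [← hu] at h3
          simpa [smul_smul] using Submodule.smul_mem _ (↑u⁻¹ : R) h3
        refine hI ⟨a, le_antisymm (fun y hy ↦ ?_) (by simpa [Ideal.span_le] using ha)⟩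
        obtain ⟨l, hl⟩ := Submodule.mem_span_singleton.1 (hle (Submodule.mem_top (x := ⟨y, hy⟩)))
        exact Submodule.mem_span_singleton.2 ⟨l, congrArg Subtype.val hl⟩
    · rintro s t ⟨g, rfl, hg⟩ ⟨h, rfl, hh⟩
      refine ⟨g + h, (mul_add _ _ _).symm, fun y ↦ ?_⟩
      rw [map_add]
      exact N.add_mem (hg y) (hh y)
  obtain ⟨g, hg, hgN⟩ := key ξ hmem
  have hg1 : ∀ y, Φ g y = y := fun y ↦ hinj (by
    have h := LinearMap.congr_fun (congrArg Φ hg) y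
    rw [map_mul, hξ] at h
    exact h.symm)
  have hbot : (⊤ : Submodule R I) = ⊥ :=
    Submodule.eq_bot_of_le_smul_of_le_jacobson_bot _ _ (IsNoetherian.noetherian _)
      (fun y _ ↦ by rw [← hg1 y]; exact hgN y) hjac
  have hx0 : (⟨x, hxI⟩ : I) ∈ (⊥ : Submodule R I) := hbot ▸ Submodule.mem_top
  exact nonZeroDivisors.ne_zero hreg (congrArg Subtype.val ((Submodule.mem_bot R).1 hx0))

end Rigid

theorem proposition4p7 (R : Type u) [CommRing R] [IsGorensteinLocalRing R]
    (hdim : ringKrullDim R = 1) (I : Ideal R) (hI : ∃ x ∈ I, x ∈ nonZeroDivisors R)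
    (hrigid : IsRigidModule R I)
    (hEnd : @IsGorensteinRing (Module.End R I) (Ideal.endCommRing I hI)) :
    I.IsPrincipal := by
  obtain ⟨x, hxI, hreg⟩ := id hI
  by_cases hxm : x ∈ IsLocalRing.maximalIdeal R
  · exact @IsRigidModule.isPrincipal_of_isGorensteinRing_end R _ I x _ _ hrigid hreg
      (Ideal.isMaximal_of_mem_of_ringKrullDim_le_one hdim.le hreg) hxI hxm (Module.End R I)
      (Ideal.endCommRing I hI) hEnd (RingEquiv.refl _)
  · rw [Ideal.eq_top_of_isUnit_mem I hxI (IsLocalRing.notMem_maximalIdeal.1 hxm)]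
    exact ⟨1, Ideal.span_singleton_one.symm⟩
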